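/- Let $n\ge 1$ and let $0<x<y$ be coprime integers. The path multigraph $P^{x,y}_n$ has vertices $u_0,\dots,u_{n+1}$; $u_0$ and $u_{n+1}$ are sinks, and each $u_k$ with $k\in\{1,\dots,n\}$ has $x+y$ outgoing arcs $a^k_0,\dots,a^k_{x+y-1}$, where $a^k_j$ goes to $u_{k+1}$ if $j<x$ and to $u_{k-1}$ if $j\ge x$. Its rotor order is $\theta(a^k_j)=a^k_{(j+1)\bmod (x+y)}$. Put $V_0=\{u_1,\dots,u_n\}$. A rotor configuration is a map $\rho$ sending each $u\in V_0$ to an arc going out of $u$ (set $\mathcal R$ of all of them); a particle configuration is an element $\sigma$ of $\Sigma=\mathbb Z^{\{u_0,\dots,u_{n+1}\}}$. For $u\in V_0$ the bijection $\mathrm{routing}^+_u$ of $\mathcal R\times\Sigma$ first replaces $\sigma$ by $\sigma+\mathrm{head}(\rho(u))-u$ (a vertex being identified with one particle on it) and then replaces $\rho(u)$ by $\theta(\rho(u))$. These bijections commute, and for $r\in\mathbb Z^{V_0}$ let $\mathrm{routing}^r$ be the composition of all $(\mathrm{routing}^+_u)^{r(u)}$. Write - $(\rho,\sigma)\sim(\rho',\sigma')$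 if $\mathrm{routing}^r(\rho,\sigma)=(\rho',\sigma')$ for some $r\in\mathbb Z^{V_0}$; - $\rho\sim\rho'$ if $(\rho,\sigma)\sim(\rho',\sigma)$ for some $\sigma\in\Sigma$, and $\sigma\sim\sigma'$ if $(\rho,\sigma)\sim(\rho,\sigma')$ for some $\rho\in\mathcal R$; - $\sigma\sim_S\sigma'$ if there is $\sigma_1\sim\sigma$ with $\sigma_1(u)=\sigma'(u)$ for all $u\in V_0$. The relation $\sim$ on $\mathcal R$ is an equivalence relation, and $\sim_S$ is a congruence of the group $\Sigma$; the sandpile group is $SP(P^{x,y}_n)=\Sigma/{\sim_S}$. Let $\mathrm{routing}^\infty(\rho,\sigma)$ be the set of all $(\rho',\sigma')\sim(\rho,\sigma)$ with $\sigma'(u)=0$ for all $u\in V_0$. Finally put $$F=\sum_{i=0}^n x^{n-i}y^i,\qquad h(u_k)=\sum_{i=0}^{k-1}x^{n-i}y^i\quad(0\le k\le n+1),$$ extend $h$ linearly to $\Sigma$, put $$g(a^k_j)=\sum_{i=0}^{j-1}\bigl(h(\mathrm{head}(a^k_i))-h(u_k)\bigr),\qquad g(\rho)=\sum_{u\in V_0}g(\rho(u)),$$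 and let $\bar h,\bar g$ be $h,g$ modulo $F$. **Theorem.** 1. The sandpile group $SP(P^{x,y}_n)$ is cyclic of order $F$. 2. The map $\bar h:\Sigma\to\mathbb Z/F\mathbb Z$ induces a group isomorphism $SP(P^{x,y}_n)\cong\mathbb Z/F\mathbb Z$. 3. The map $\bar g:\mathcal R\to\mathbb Z/F\mathbb Z$ induces a bijection between the equivalence classes of rotor configurations and $\mathbb Z/F\mathbb Z$. 4. For every $(\rho,\sigma)\in\mathcal R\times\Sigma$ the set $\mathrm{routing}^\infty(\rho,\sigma)$ is nonempty, and every $(\rho',\sigma')\in\mathrm{routing}^\infty(\rho,\sigma)$ satisfies $\bar g(\rho')=\bar g(\rho)-\bar h(\sigma)$. -/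

import Mathlib

/-- A directed multigraph with vertex set `V` and arc set `A`, later assumed finite (multiple arcs and loops are
allowed), together with a rotor order `θ`: a permutation of the arcs which preserves tails and is
such that, for every vertex `u`, the arcs going out of `u` form one single orbit. -/
structure RotorGraph (V A : Type*) where
  head : A → V
  tail : A → V
  θ : Equiv.Perm A
  tail_θ : ∀ a, tail (θ a) = tail a
  orbit_θ : ∀ a b, tail a = tail b → ∃ k : ℕ, (θ ^ k) a = b

namespace RotorGraph

variable {V A : Type*} (G : RotorGraph V A)

/-- The set `V₀` of vertices with positive outdegree; the other vertices are the sinks. -/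
abbrev V₀ : Type _ := {u : V // ∃ a, G.tail a = u}

/-- Rotor configurations: each vertex `u ∈ V₀` gets an arc going out of `u`. -/
abbrev RotorConfig : Type _ := {ρ : G.V₀ → A // ∀ u, G.tail (ρ u) = u}

/-- Particle configurations: each vertex (sinks included) gets an integer. -/
abbrev ParticleConfig (_G : RotorGraph V A) : Type _ := V → ℤ

theorem tail_θ_symm (a : A) : G.tail (G.θ.symm a) = G.tail a := by
  rw [← G.tail_θ (G.θ.symm a), Equiv.apply_symm_apply]

theorem nonempty_rotorConfig : Nonempty G.RotorConfig := by
  have h : ∀ u : G.V₀, ∃ a, G.tail a = u := fun u => u.2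
  choose f hf using h
  exact ⟨⟨f, hf⟩⟩

variable [DecidableEq V]

/-- `move⁺_u (ρ, σ) = (ρ, σ + head (ρ u) - u)`. -/
def move (u : G.V₀) : Equiv.Perm (G.RotorConfig × G.ParticleConfig) where
  toFun p := (p.1, p.2 + Pi.single (G.head (p.1.1 u)) 1 - Pi.single u.1 1)
  invFun p := (p.1, p.2 - Pi.single (G.head (p.1.1 u)) 1 + Pi.single u.1 1)
  left_inv p := Prod.ext rfl (by simp only; abel)
  right_inv p := Prod.ext rfl (by simp only; abel)

/-- `turn⁺_u (ρ, σ) = (θ_u ∘ ρ, σ)`: the rotor at `u` is advanced by one step. -/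
def turn (u : G.V₀) : Equiv.Perm (G.RotorConfig × G.ParticleConfig) where
  toFun p := (⟨Function.update p.1.1 u (G.θ (p.1.1 u)), fun v => by
    by_cases h : v = u
    · subst h; simp [G.tail_θ, p.1.2]
    · simp [h, p.1.2]⟩, p.2)
  invFun p := (⟨Function.update p.1.1 u (G.θ.symm (p.1.1 u)), fun v => by
    by_cases h : v = u
    · subst h; simp [G.tail_θ_symm, p.1.2]
    · simp [h, p.1.2]⟩, p.2)
  left_inv p := by ext <;> simp
  right_inv p := by ext <;> simp

/-- `routing⁺_u`: first move a particle, then turn the rotor. -/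
def routingStep (u : G.V₀) : Equiv.Perm (G.RotorConfig × G.ParticleConfig) :=
  G.turn u * G.move u

theorem routingStep_commute (u v : G.V₀) : Commute (G.routingStep u) (G.routingStep v) := by
  by_cases h : u = v
  · subst h; exact Commute.refl _
  · have h' : v ≠ u := fun e => h e.symm
    apply Equiv.ext
    intro p
    refine Prod.ext (Subtype.ext ?_) ?_
    · simp only [routingStep, move, turn, Equiv.Perm.mul_apply, Equiv.coe_fn_mk,
        Function.update_of_ne h, Function.update_of_ne h']
      exact Function.update_comm h' _ _ _
    · simp only [routingStep, move, turn, Equiv.Perm.mul_apply, Equiv.coe_fn_mk,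
        Function.update_of_ne h, Function.update_of_ne h']
      abel

theorem routingStep_zpow_commute (r s : G.V₀ → ℤ) (u v : G.V₀) :
    Commute (G.routingStep u ^ r u) (G.routingStep v ^ s v) :=
  ((G.routingStep_commute u v).zpow_left _).zpow_right _

theorem routingStep_zpow_pairwise (r : G.V₀ → ℤ) (S : Set G.V₀) :
    S.Pairwise (Function.onFun Commute fun u => G.routingStep u ^ r u) :=
  fun u _ v _ _ => G.routingStep_zpow_commute r r u v

theorem routingStep_zpow_rotor (u v : G.V₀) (k : ℤ) (p : G.RotorConfig × G.ParticleConfig) :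
    ((G.routingStep u ^ k) p).1.1 v = if v = u then (G.θ ^ k) (p.1.1 v) else p.1.1 v := by
  have h1 : ∀ q, (G.routingStep u q).1.1 v = if v = u then G.θ (q.1.1 v) else q.1.1 v := by
    intro q
    by_cases h : v = u
    · subst h; simp [routingStep, move, turn]
    · simp [routingStep, move, turn, h]
  induction k with
  | zero => simp
  | succ k ih =>
    rw [add_comm, zpow_add, zpow_one, Equiv.Perm.mul_apply, h1, ih]
    split_ifs <;> simp [zpow_add]
  | pred k ih =>
    have h2 := h1 ((G.routingStep u ^ (-(k : ℤ) - 1)) p)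
    rw [← Equiv.Perm.mul_apply, ← zpow_one_add, add_sub_cancel, ih] at h2
    split_ifs at h2 ⊢ with h
    · apply G.θ.injective
      rw [← h2, ← Equiv.Perm.mul_apply, ← zpow_one_add, add_sub_cancel]
    · exact h2.symm

variable [Fintype V] [Fintype A]

/-- `routing^r` for a routing vector `r : V₀ → ℤ`: the composition of all `(routing⁺_u)^{r(u)}`,
in any order. -/
def routing (r : G.V₀ → ℤ) : Equiv.Perm (G.RotorConfig × G.ParticleConfig) :=
  Finset.univ.noncommProd (fun u => G.routingStep u ^ r u)
    (G.routingStep_zpow_pairwise r _)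

/-- Equivalence of rotor-particle configurations: one is routed to the other by some `r`. -/
def RPEquiv (p q : G.RotorConfig × G.ParticleConfig) : Prop :=
  ∃ r : G.V₀ → ℤ, G.routing r p = q

/-- Equivalence of rotor configurations. -/
def RotorEquiv (ρ ρ' : G.RotorConfig) : Prop :=
  ∃ σ : G.ParticleConfig, G.RPEquiv (ρ, σ) (ρ', σ)

/-- Equivalence of particle configurations. -/
def ParticleEquiv (σ σ' : G.ParticleConfig) : Prop :=
  ∃ ρ : G.RotorConfig, G.RPEquiv (ρ, σ) (ρ, σ')

/-- The relation `∼_S`: equivalence of particle configurations up to the values on sinks. -/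
def SandpileEquiv (σ σ' : G.ParticleConfig) : Prop :=
  ∃ σ₁ : G.ParticleConfig, G.ParticleEquiv σ σ₁ ∧ ∀ u : G.V₀, σ' u = σ₁ u

/-- `routing^∞ (ρ, σ)`: all configurations equivalent to `(ρ, σ)` with no particle (and no
antiparticle) left outside the sinks. -/
def routingInfty (p : G.RotorConfig × G.ParticleConfig) :
    Set (G.RotorConfig × G.ParticleConfig) :=
  {q | G.RPEquiv p q ∧ ∀ u : G.V₀, q.2 u = 0}

/-! The relations above are compatible with the structures, so that quotients can be formed. -/

theorem routing_add (r s : G.V₀ → ℤ) : G.routing (r + s) = G.routing r * G.routing s := by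
  unfold routing
  rw [← Finset.noncommProd_mul_distrib _ _ _ _
    (fun u _ v _ _ => G.routingStep_zpow_commute s r u v)]
  refine Finset.noncommProd_congr rfl (fun u _ => ?_) _
  simp [zpow_add]

theorem routing_zero : G.routing 0 = 1 := by
  have h := G.routing_add 0 0
  rw [add_zero] at h
  exact (left_eq_mul.mp h)

theorem routing_neg (r : G.V₀ → ℤ) : G.routing (-r) = (G.routing r)⁻¹ := by
  rw [eq_inv_iff_mul_eq_one, ← routing_add, neg_add_cancel, routing_zero]

theorem rpEquiv_refl (p : G.RotorConfig × G.ParticleConfig) : G.RPEquiv p p :=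
  ⟨0, by rw [routing_zero]; rfl⟩

variable {G} in
theorem RPEquiv.symm {p q : G.RotorConfig × G.ParticleConfig} (h : G.RPEquiv p q) :
    G.RPEquiv q p := by
  obtain ⟨r, rfl⟩ := h
  exact ⟨-r, by rw [routing_neg]; exact (G.routing r).symm_apply_apply p⟩

variable {G} in
theorem RPEquiv.trans {p q w : G.RotorConfig × G.ParticleConfig} (h : G.RPEquiv p q)
    (h' : G.RPEquiv q w) : G.RPEquiv p w := by
  obtain ⟨r, rfl⟩ := h
  obtain ⟨s, rfl⟩ := h'
  exact ⟨s + r, by rw [routing_add]; rfl⟩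

/-- Adding `τ` to the particle configuration. -/
def translate (τ : G.ParticleConfig) : Equiv.Perm (G.RotorConfig × G.ParticleConfig) where
  toFun p := (p.1, p.2 + τ)
  invFun p := (p.1, p.2 - τ)
  left_inv p := by ext <;> simp
  right_inv p := by ext <;> simp

theorem translate_commute (τ : G.ParticleConfig) (r : G.V₀ → ℤ) :
    Commute (G.translate τ) (G.routing r) := by
  refine Finset.noncommProd_commute _ _ _ _ fun u _ => Commute.zpow_right ?_ _
  apply Equiv.ext
  intro p
  refine Prod.ext rfl ?_
  simp only [translate, routingStep, move, turn, Equiv.Perm.mul_apply, Equiv.coe_fn_mk]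
  abel

theorem routing_translate (r : G.V₀ → ℤ) (ρ : G.RotorConfig) (σ τ : G.ParticleConfig) :
    G.routing r (ρ, σ + τ) = ((G.routing r (ρ, σ)).1, (G.routing r (ρ, σ)).2 + τ) :=
  (DFunLike.congr_fun (G.translate_commute τ r) (ρ, σ)).symm

variable {G} in
theorem RPEquiv.translate {ρ ρ' : G.RotorConfig} {σ σ' : G.ParticleConfig}
    (h : G.RPEquiv (ρ, σ) (ρ', σ')) (τ : G.ParticleConfig) :
    G.RPEquiv (ρ, σ + τ) (ρ', σ' + τ) := by
  obtain ⟨r, h⟩ := h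
  exact ⟨r, by rw [routing_translate, h]⟩

theorem routing_rotor (r : G.V₀ → ℤ) (p : G.RotorConfig × G.ParticleConfig) (v : G.V₀) :
    (G.routing r p).1.1 v = (G.θ ^ r v) (p.1.1 v) := by
  have key : ∀ S : Finset G.V₀, ((S.noncommProd (fun u => G.routingStep u ^ r u)
      (G.routingStep_zpow_pairwise r _)) p).1.1 v =
      if v ∈ S then (G.θ ^ r v) (p.1.1 v) else p.1.1 v := by
    intro S
    induction S using Finset.induction_on with
    | empty => simp
    | insert u S hu ih =>
      rw [Finset.noncommProd_insert_of_notMem _ _ _ _ hu, Equiv.Perm.mul_apply,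
        routingStep_zpow_rotor, ih]
      by_cases h : v = u
      · subst h; simp [hu]
      · simp [h]
  exact (key Finset.univ).trans (by simp)

theorem exists_routing_rotor (ρ ρ' : G.RotorConfig) :
    ∃ τ : G.ParticleConfig, G.RPEquiv (ρ, 0) (ρ', τ) := by
  have h : ∀ v, ∃ k : ℕ, (G.θ ^ k) (ρ.1 v) = ρ'.1 v :=
    fun v => G.orbit_θ _ _ ((ρ.2 v).trans (ρ'.2 v).symm)
  choose k hk using h
  refine ⟨(G.routing (fun v => (k v : ℤ)) (ρ, 0)).2, fun v => (k v : ℤ), Prod.ext ?_ rfl⟩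
  refine Subtype.ext (funext fun v => ?_)
  rw [routing_rotor, zpow_natCast]
  exact hk v

variable {G} in
theorem ParticleEquiv.all {σ σ' : G.ParticleConfig} (h : G.ParticleEquiv σ σ')
    (ρ' : G.RotorConfig) : G.RPEquiv (ρ', σ) (ρ', σ') := by
  obtain ⟨ρ, h⟩ := h
  obtain ⟨τ, hτ⟩ := G.exists_routing_rotor ρ ρ'
  have h1 := hτ.translate σ
  have h2 := hτ.translate σ'
  rw [zero_add] at h1 h2
  have h3 := ((h1.symm.trans h).trans h2).translate (-τ)
  rwa [add_neg_cancel_comm, add_neg_cancel_comm] at h3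

variable {G} in
theorem RotorEquiv.all {ρ ρ' : G.RotorConfig} (h : G.RotorEquiv ρ ρ')
    (τ : G.ParticleConfig) : G.RPEquiv (ρ, τ) (ρ', τ) := by
  obtain ⟨σ, h⟩ := h
  simpa using h.translate (τ - σ)

/-- Equivalence of rotor configurations as an equivalence relation. -/
def rotorSetoid : Setoid G.RotorConfig where
  r := G.RotorEquiv
  iseqv :=
    { refl := fun _ => ⟨0, G.rpEquiv_refl _⟩
      symm := fun h => ⟨0, (h.all 0).symm⟩
      trans := fun h h' => ⟨0, (h.all 0).trans (h'.all 0)⟩ }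

/-- Rotor equivalence classes. -/
abbrev RotorClass : Type _ := Quotient G.rotorSetoid

/-- The relation `∼_S` as a congruence of the additive group of particle configurations. -/
def sandpileCon : AddCon G.ParticleConfig where
  r := G.SandpileEquiv
  iseqv :=
    { refl := fun σ => by
        obtain ⟨ρ⟩ := G.nonempty_rotorConfig
        exact ⟨σ, ⟨ρ, G.rpEquiv_refl _⟩, fun _ => rfl⟩
      symm := by
        rintro σ σ' ⟨σ₁, ⟨ρ, h⟩, h'⟩
        refine ⟨σ + (σ' - σ₁), ⟨ρ, ?_⟩, fun u => ?_⟩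
        · simpa using h.symm.translate (σ' - σ₁)
        · simp [h' u]
      trans := by
        rintro σ σ' σ'' ⟨σ₁, ⟨ρ, h⟩, h'⟩ ⟨σ₂, k, k'⟩
        refine ⟨σ₂ + (σ₁ - σ'), ⟨ρ, h.trans ?_⟩, fun u => ?_⟩
        · simpa using (k.all ρ).translate (σ₁ - σ')
        · simp [h' u, k' u] }
  add' := by
    rintro σ σ' τ τ' ⟨σ₁, ⟨ρ, h⟩, h'⟩ ⟨τ₁, k, k'⟩
    refine ⟨σ₁ + τ₁, ⟨ρ, (h.translate τ).trans ?_⟩, fun u => ?_⟩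
    · simpa [add_comm] using (k.all ρ).translate σ₁
    · simp [h' u, k' u]

/-- The sandpile group: the quotient of the group of particle configurations by `∼_S`. -/
abbrev SandpileGroup : Type _ := G.sandpileCon.Quotient

end RotorGraph

/-- The path multigraph `P_n^{x,y}` with its rotor order. The vertices are `u_0, …, u_{n+1}`. For
`k : Fin n` and `j : Fin (x + y)`, the pair `(k, j)` is the arc number `j` out of `u_{k+1}`; it
goes to the right (to `u_{k+2}`) if `j < x` and to the left (to `u_k`) if `x ≤ j`. The rotor order
sends the arc number `j` to the arc number `j + 1` modulo `x + y`. -/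
def pathGraphXY (x y n : ℕ) : RotorGraph (Fin (n + 2)) (Fin n × Fin (x + y)) where
  head a := if (a.2 : ℕ) < x then ⟨a.1 + 2, by omega⟩ else ⟨a.1, by omega⟩
  tail a := ⟨a.1 + 1, by omega⟩
  θ := (Equiv.refl _).prodCongr (finRotate (x + y))
  tail_θ _ := rfl
  orbit_θ := by
    rintro ⟨k, i⟩ ⟨k', j⟩ h
    have hk : k = k' := by
      have := congrArg Fin.val h
      simp only [Nat.add_right_cancel_iff] at this
      exact Fin.ext this
    subst hk
    have : NeZero (x + y) := i.neZero
    have hrot : ∀ t : ℕ, (((Equiv.refl (Fin n)).prodCongr (finRotate (x + y))) ^ t) (k, i)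
        = (k, i + Fin.ofNat (x + y) t) := by
      intro t
      induction t with
      | zero =>
        refine Prod.ext rfl (Fin.ext ?_)
        simp
      | succ t ih =>
        rw [pow_succ', Equiv.Perm.mul_apply, ih]
        refine Prod.ext rfl (Fin.ext ?_)
        simp [finRotate_apply, Fin.val_add, add_assoc]
    refine ⟨((j - i : Fin (x + y)) : ℕ), ?_⟩
    rw [hrot]
    refine Prod.ext rfl ?_
    simp

/-- `F = ∑_{i=0}^{n} x^{n-i} y^i`. -/
def pathF (x y n : ℕ) : ℕ := ∑ i ∈ Finset.range (n + 1), x ^ (n - i) * y ^ i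

/-- `h(u_k) = ∑_{i=0}^{k-1} x^{n-i} y^i`. -/
def pathHVertex (x y n : ℕ) (k : Fin (n + 2)) : ℤ :=
  ∑ i ∈ Finset.range (k : ℕ), (x : ℤ) ^ (n - i) * (y : ℤ) ^ i

/-- The linear extension of `h` to particle configurations. -/
def pathH (x y n : ℕ) (σ : (pathGraphXY x y n).ParticleConfig) : ℤ :=
  ∑ k, σ k * pathHVertex x y n k

/-- `g(a_j^k) = ∑_{i=0}^{j-1} (h(head(a_i^k)) - h(u_k))`. -/
def pathGArc (x y n : ℕ) (a : Fin n × Fin (x + y)) : ℤ :=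
  ∑ i ∈ Finset.Iio a.2,
    (pathHVertex x y n ((pathGraphXY x y n).head (a.1, i)) -
      pathHVertex x y n ((pathGraphXY x y n).tail a))

/-- `g(ρ) = ∑_{u ∈ V₀} g(ρ(u))`. -/
def pathG (x y n : ℕ) (ρ : (pathGraphXY x y n).RotorConfig) : ℤ :=
  ∑ u, pathGArc x y n (ρ.1 u)

/-!
The proof rests on one invariant and one sign argument.

*The invariant.* The potential `h` is harmonic: `x (h(u_{k+1}) - h(u_k)) = y (h(u_k) - h(u_{k-1}))`.
Therefore `g` is a well-defined primitive of the increments of `h` along the rotor order, and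
routing preserves the integer `h(σ) - g(ρ)` (`pathH_sub_pathG_eq`). Since `h` vanishes at `u_0` and
equals `F` at `u_{n+1}`, this makes `h` modulo `F` well defined on the sandpile group and `g` well
defined on rotor classes, and it gives the formula for `g(ρ')` after complete routing.

*The sandpile group.* In it the differences `d_k = [u_{k+1}] - [u_k]` satisfy `x d_k = y d_{k-1}`, by
a full turn of one rotor. As `x` and `y` are coprime, repeated Bézout combinations
(`exists_eq_pow_mul_pow_smul`) give one `e` with `d_k = x^{n-k} y^k e`; hence `[σ] = h(σ) e` and
`F e = [u_{n+1}] = 0`, so that `h` modulo `F` is injective (`sandpileMk_eq_zero_iff`). It is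
surjective because `h(u_1) = x^n` is prime to `F`.

*Injectivity of `g` on rotor classes.* If `g(ρ) ≡ g(ρ')` modulo `F`, the previous paragraph routes
`(ρ, 0)` to `(ρ', τ)` with `τ` supported on the sinks, and one has to exclude `τ ≠ 0`. The net
flow through each edge is the same number `c`. If `c > 0`, then `u_1` sends a negative number of
particles to the left, so its rotor is turned backwards and it sends at most `0` to the right, so
`u_2` sends a negative number to the left, and so on up to the right sink, which sends nothing
(`last_le_of_rpEquiv`). By symmetry `c = 0` (`eq_of_rpEquiv`).

*Surjectivity of `g`.* The configurations without cycles, whose rotors point to the left at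
`u_1, …, u_m` and to the right afterwards, number `∑ y^m x^{n-m} = F` (`card_forestCode`). The same
analysis of signs shows that two equivalent ones are equal (`IsForest.eq_of_rotorEquiv`), so `g`
takes `F` distinct residues on them. Finally, a complete routing of `(ρ, σ)` exists: its rotor part
can be any `ρ'` whose residue is the one that the invariant predicts.
-/

/-! ### Displacement of particles under routing -/

namespace RotorGraph

variable {V A : Type*} (G : RotorGraph V A) [DecidableEq V]

/-- The displacement of the particles under `(routing⁺_u)^m` depends on the rotor at `u` only. -/
theorem routingStep_zpow_particle_sub_eq (u : G.V₀) (m : ℤ) (p q : G.RotorConfig × G.ParticleConfig)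
    (h : p.1.1 u = q.1.1 u) :
    ((G.routingStep u ^ m) p).2 - p.2 = ((G.routingStep u ^ m) q).2 - q.2 := by
  have key : ∀ (m : ℕ) (p q : G.RotorConfig × G.ParticleConfig), p.1.1 u = q.1.1 u →
      ((G.routingStep u ^ m) p).2 - p.2 = ((G.routingStep u ^ m) q).2 - q.2 := by
    intro m
    induction m with
    | zero => intro p q _; simp
    | succ m ih =>
      intro p q h
      have h1 : ((G.routingStep u) p).1.1 u = ((G.routingStep u) q).1.1 u := by
        simp [routingStep, move, turn, h]
      have h2 : ((G.routingStep u) p).2 - p.2 = ((G.routingStep u) q).2 - q.2 := by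
        simp only [routingStep, move, turn, Equiv.Perm.mul_apply, Equiv.coe_fn_mk, h]
        abel
      rw [pow_succ, Equiv.Perm.mul_apply, Equiv.Perm.mul_apply,
        ← sub_add_sub_cancel _ ((G.routingStep u) p).2, ih _ _ h1, h2, sub_add_sub_cancel]
  obtain ⟨k, rfl | rfl⟩ := m.eq_nat_or_neg
  · exact_mod_cast key k p q h
  · -- A negative power is undone by the positive one, applied at its endpoint.
    have h1 := key k ((G.routingStep u ^ (-(k : ℤ))) p) ((G.routingStep u ^ (-(k : ℤ))) q) (by
      simp only [routingStep_zpow_rotor, h])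
    simp only [← Equiv.Perm.mul_apply, ← zpow_natCast, ← zpow_add, add_neg_cancel, zpow_zero,
      Equiv.Perm.one_apply] at h1
    rw [← neg_sub, h1, neg_sub]

variable [Fintype V] [Fintype A]

/-- The displacement under `routing^r` is the sum of the displacements at the single vertices. -/
theorem routing_particle (r : G.V₀ → ℤ) (p : G.RotorConfig × G.ParticleConfig) :
    (G.routing r p).2 = p.2 + ∑ u, (((G.routingStep u ^ r u) p).2 - p.2) := by
  have key : ∀ S : Finset G.V₀,
      (∀ v ∉ S, ((S.noncommProd (fun u => G.routingStep u ^ r u)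
        (G.routingStep_zpow_pairwise r _)) p).1.1 v = p.1.1 v) ∧
      ((S.noncommProd (fun u => G.routingStep u ^ r u) (G.routingStep_zpow_pairwise r _)) p).2 =
        p.2 + ∑ u ∈ S, (((G.routingStep u ^ r u) p).2 - p.2) := by
    intro S
    induction S using Finset.induction_on with
    | empty => simp
    | insert u S hu ih =>
      refine ⟨fun v hv => ?_, ?_⟩
      · rw [Finset.mem_insert, not_or] at hv
        rw [Finset.noncommProd_insert_of_notMem _ _ _ _ hu, Equiv.Perm.mul_apply,
          routingStep_zpow_rotor, if_neg hv.1, ih.1 v hv.2]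
      · rw [Finset.noncommProd_insert_of_notMem _ _ _ _ hu, Equiv.Perm.mul_apply,
          Finset.sum_insert hu,
          ← G.routingStep_zpow_particle_sub_eq u (r u) _ p (ih.1 u hu), ih.2]
        abel
  exact (key Finset.univ).2

theorem routing_single (u : G.V₀) (m : ℤ) :
    G.routing (Pi.single u m) = G.routingStep u ^ m := by
  apply Equiv.ext
  intro p
  refine Prod.ext (Subtype.ext (funext fun v => ?_)) ?_
  · rw [routing_rotor, routingStep_zpow_rotor]
    by_cases h : v = u
    · subst h; simp
    · simp [h]
  · rw [routing_particle, Finset.sum_eq_single u]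
    · simp
    · intro v _ h
      simp [h]
    · simp

/-- A function preserved by each `routing⁺_u` is constant on equivalence classes. -/
theorem RPEquiv.map_eq {G : RotorGraph V A} {α : Type*} (Φ : G.RotorConfig × G.ParticleConfig → α)
    (hΦ : ∀ u p, Φ (G.routingStep u p) = Φ p) {p q : G.RotorConfig × G.ParticleConfig}
    (h : G.RPEquiv p q) : Φ q = Φ p := by
  obtain ⟨r, rfl⟩ := h
  let H : Subgroup (Equiv.Perm (G.RotorConfig × G.ParticleConfig)) :=
    { carrier := {e | ∀ p, Φ (e p) = Φ p}
      mul_mem' := fun ha hb p => (ha _).trans (hb p)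
      one_mem' := fun _ => rfl
      inv_mem' := fun {e} he p => by
        rw [← he (e⁻¹ p)]
        exact congrArg Φ (e.apply_symm_apply p) }
  have hr : G.routing r ∈ H :=
    Subgroup.noncommProd_mem H _ fun u _ => H.zpow_mem (hΦ u) _
  exact hr p

end RotorGraph

/-! ### Geometric progressions in groups and cyclic rotations -/

/-- If consecutive terms satisfy `x d_{k+1} = y d_k` with `x`, `y` coprime, then
`d_0, …, d_n` are the multiples `x^{n-k} y^k e` of one element `e`. -/
theorem exists_eq_pow_mul_pow_smul {M : Type*} [AddCommGroup M] {x y : ℕ} (hcop : x.Coprime y)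
    (d : ℕ → M) (n : ℕ) (hd : ∀ k < n, (x : ℤ) • d (k + 1) = (y : ℤ) • d k) :
    ∃ e : M, ∀ k ≤ n, d k = ((x : ℤ) ^ (n - k) * (y : ℤ) ^ k) • e := by
  induction n with
  | zero => exact ⟨d 0, fun k hk => by simp [Nat.le_zero.mp hk]⟩
  | succ n ih =>
    obtain ⟨e, he⟩ := ih fun k hk => hd k (by omega)
    obtain ⟨a, b, hab⟩ : IsCoprime (x : ℤ) ((y : ℤ) ^ (n + 1)) :=
      (Nat.isCoprime_iff_coprime.mpr hcop).pow_right
    have h1 : (x : ℤ) • d (n + 1) = ((y : ℤ) ^ (n + 1)) • e := by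
      rw [hd n (by omega), he n le_rfl, smul_smul]
      congr 1
      simp only [tsub_self, pow_zero]
      ring
    -- A Bézout combination `e'` of `e` and `d (n + 1)` has `x e' = e` and `y^{n+1} e' = d (n + 1)`.
    have hx : (x : ℤ) • (a • e + b • d (n + 1)) = e := by
      rw [smul_add, smul_comm (x : ℤ) b, h1, smul_smul, smul_smul, ← add_smul, mul_comm _ a, hab,
        one_smul]
    refine ⟨a • e + b • d (n + 1), fun k hk => ?_⟩
    rcases Nat.lt_or_ge n k with h | h
    · obtain rfl : k = n + 1 := by omega
      rw [tsub_self, pow_zero, one_mul, smul_add, smul_comm _ a, ← h1, smul_smul, smul_smul,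
        ← add_smul, mul_comm _ b, hab, one_smul]
    · conv_lhs => rw [he k h, ← hx, smul_smul]
      rw [Nat.succ_sub h, pow_succ]
      congr 1
      ring

/-- Summing over an initial segment of `Fin N` turns a function of total `0` into a primitive for
the cyclic rotation. -/
theorem Fin.sum_Iio_finRotate {M : Type*} [AddCommGroup M] {N : ℕ} (f : Fin N → M)
    (hf : ∑ i, f i = 0) (j : Fin N) :
    ∑ i ∈ Finset.Iio (finRotate N j), f i = ∑ i ∈ Finset.Iio j, f i + f j := by
  have hins : ∑ i ∈ Finset.Iic j, f i = ∑ i ∈ Finset.Iio j, f i + f j := by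
    rw [← Finset.Iio_insert, Finset.sum_insert (by simp), add_comm]
  rw [← hins]
  obtain _ | N := N
  · exact j.elim0
  by_cases h : j = Fin.last N
  · subst h
    have h1 : Finset.Iio (finRotate (N + 1) (Fin.last N)) = ∅ := by
      ext i; simp
    have h2 : Finset.Iic (Fin.last N) = Finset.univ := by
      ext i; simp [Fin.le_last]
    rw [h1, h2, hf, Finset.sum_empty]
  · congr 1
    ext i
    have hj := coe_finRotate_of_ne_last h
    simp only [Finset.mem_Iio, Finset.mem_Iic, Fin.lt_def, Fin.le_def, hj]
    omega

theorem finRotate_pow_self (N : ℕ) : finRotate N ^ N = 1 := by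
  obtain _ | N := N
  · simp
  have h : ∀ t : ℕ, ∀ i : Fin (N + 1), (finRotate (N + 1) ^ t) i = i + Fin.ofNat (N + 1) t := by
    intro t i
    induction t with
    | zero => ext; simp
    | succ t ih =>
      rw [pow_succ', Equiv.Perm.mul_apply, ih]
      ext
      simp [finRotate_apply, Fin.val_add, add_assoc]
  ext i
  rw [h]
  simp

/-! ### The potential of the path and its invariant -/

namespace PathMultigraph

variable {x y n : ℕ}

/-- The enumeration of the non-sink vertices: `i : Fin n` stands for `u_{i+1}`. -/
noncomputable def inner (hx : 0 < x) : Fin n ≃ (pathGraphXY x y n).V₀ :=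
  Equiv.ofBijective
    (fun i => ⟨⟨i + 1, by omega⟩, (i, ⟨0, by omega⟩), rfl⟩)
    ⟨fun i j h => by
      have := congrArg (fun u : (pathGraphXY x y n).V₀ => (u.1 : ℕ)) h
      simp only [Nat.add_right_cancel_iff] at this
      exact Fin.ext this,
    fun ⟨u, a, ha⟩ => ⟨a.1, Subtype.ext ha⟩⟩

theorem rotor_inner_fst (hx : 0 < x) (ρ : (pathGraphXY x y n).RotorConfig) (i : Fin n) :
    (ρ.1 (inner hx i)).1 = i := by
  have h : ((ρ.1 (inner hx i)).1 : ℕ) + 1 = i + 1 := congrArg Fin.val (ρ.2 (inner hx i))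
  exact Fin.ext (Nat.add_right_cancel h)

theorem head_of_lt (a : Fin n × Fin (x + y)) (h : (a.2 : ℕ) < x) :
    (pathGraphXY x y n).head a = ⟨a.1 + 2, by omega⟩ := if_pos h

theorem head_of_le (a : Fin n × Fin (x + y)) (h : x ≤ (a.2 : ℕ)) :
    (pathGraphXY x y n).head a = ⟨a.1, by omega⟩ := if_neg h.not_gt

/-- Along an arc out of `u_{k+1}` the potential `h` changes by `c y` to the right and by `-c x` to
the left, with `c = x^{n-1-k} y^k`. -/
theorem pathHVertex_head_sub_tail (k : Fin n) (j : Fin (x + y)) :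
    pathHVertex x y n ((pathGraphXY x y n).head (k, j)) -
      pathHVertex x y n ((pathGraphXY x y n).tail (k, j)) =
    if (j : ℕ) < x then (x : ℤ) ^ (n - 1 - (k : ℕ)) * (y : ℤ) ^ (k : ℕ) * y
      else -((x : ℤ) ^ (n - 1 - (k : ℕ)) * (y : ℤ) ^ (k : ℕ) * x) := by
  obtain ⟨k, hk⟩ := k
  split_ifs with h
  · rw [head_of_lt _ h]
    simp only [pathHVertex, pathGraphXY, Finset.sum_range_succ]
    rw [show n - 1 - k = n - (k + 1) by omega]
    ring
  · rw [head_of_le _ (not_lt.mp h)]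
    simp only [pathHVertex, pathGraphXY, Finset.sum_range_succ]
    rw [show n - k = n - 1 - k + 1 by omega]
    ring

/-- The potential `h` is harmonic at the non-sink vertices. -/
theorem sum_pathHVertex_head_sub_tail (k : Fin n) :
    ∑ j : Fin (x + y), (pathHVertex x y n ((pathGraphXY x y n).head (k, j)) -
      pathHVertex x y n ((pathGraphXY x y n).tail (k, j))) = 0 := by
  simp only [pathHVertex_head_sub_tail]
  rw [Fin.sum_univ_add]
  simp
  ring

theorem pathGArc_θ (a : Fin n × Fin (x + y)) :
    pathGArc x y n ((pathGraphXY x y n).θ a) = pathGArc x y n a +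
      (pathHVertex x y n ((pathGraphXY x y n).head a) -
        pathHVertex x y n ((pathGraphXY x y n).tail a)) := by
  obtain ⟨k, j⟩ := a
  exact Fin.sum_Iio_finRotate _ (sum_pathHVertex_head_sub_tail k) j

/-- `h` as an additive homomorphism on particle configurations. -/
def pathHHom (x y n : ℕ) : (pathGraphXY x y n).ParticleConfig →+ ℤ where
  toFun := pathH x y n
  map_zero' := by simp [pathH]
  map_add' σ τ := by simp [pathH, add_mul, Finset.sum_add_distrib]

theorem pathH_single (u : Fin (n + 2)) (m : ℤ) :
    pathHHom x y n (Pi.single u m) = m * pathHVertex x y n u := by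
  change pathH x y n _ = _
  rw [pathH, Finset.sum_eq_single u]
  · simp
  · intro v _ hv
    simp [hv]
  · simp

theorem pathH_sub_pathG_routingStep (u : (pathGraphXY x y n).V₀)
    (p : (pathGraphXY x y n).RotorConfig × (pathGraphXY x y n).ParticleConfig) :
    pathHHom x y n ((pathGraphXY x y n).routingStep u p).2 -
      pathG x y n ((pathGraphXY x y n).routingStep u p).1 =
    pathHHom x y n p.2 - pathG x y n p.1 := by
  have h1 : pathHHom x y n ((pathGraphXY x y n).routingStep u p).2 = pathHHom x y n p.2 +
      (pathHVertex x y n ((pathGraphXY x y n).head (p.1.1 u)) - pathHVertex x y n u) := by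
    simp only [RotorGraph.routingStep, RotorGraph.move, RotorGraph.turn, Equiv.Perm.mul_apply,
      Equiv.coe_fn_mk, map_add, map_sub, pathH_single]
    ring
  have h2 : pathG x y n ((pathGraphXY x y n).routingStep u p).1 = pathG x y n p.1 +
      (pathHVertex x y n ((pathGraphXY x y n).head (p.1.1 u)) - pathHVertex x y n u) := by
    rw [← p.1.2 u, ← sub_eq_iff_eq_add', pathG, pathG, ← Finset.sum_sub_distrib,
      Finset.sum_eq_single u]
    · rw [sub_eq_iff_eq_add', ← pathGArc_θ]
      simp [RotorGraph.routingStep, RotorGraph.move, RotorGraph.turn]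
    · intro v _ hv
      simp [RotorGraph.routingStep, RotorGraph.move, RotorGraph.turn, hv]
    · simp
  rw [h1, h2]
  ring

/-- The integer `h(σ) - g(ρ)` is an invariant of routing. -/
theorem pathH_sub_pathG_eq {ρ ρ' : (pathGraphXY x y n).RotorConfig}
    {σ σ' : (pathGraphXY x y n).ParticleConfig}
    (h : (pathGraphXY x y n).RPEquiv (ρ, σ) (ρ', σ')) :
    pathHHom x y n σ' - pathG x y n ρ' = pathHHom x y n σ - pathG x y n ρ :=
  h.map_eq (fun p => pathHHom x y n p.2 - pathG x y n p.1) pathH_sub_pathG_routingStep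

theorem pathHVertex_last : pathHVertex x y n (Fin.last (n + 1)) = pathF x y n := by
  simp [pathHVertex, pathF]

theorem pathHVertex_zero : pathHVertex x y n 0 = 0 := by
  simp [pathHVertex]

/-! ### Flows along the path -/

/-- The particles displaced by `(routing⁺_u)^m` at `u = u_{i+1}`: `R` of them go to the right and
`L` to the left, with the sign of `m`; when `m` is positive, the first one follows the rotor. -/
theorem exists_right_left (hx : 0 < x) (i : Fin n) (m : ℤ)
    (p : (pathGraphXY x y n).RotorConfig × (pathGraphXY x y n).ParticleConfig) :
    ∃ R L : ℤ, (((pathGraphXY x y n).routingStep (inner hx i) ^ m) p).2 - p.2 =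
        Pi.single ⟨i + 2, by omega⟩ R + Pi.single ⟨i, by omega⟩ L -
          Pi.single ⟨i + 1, by omega⟩ m ∧
      R + L = m ∧ (0 ≤ m → 0 ≤ R ∧ 0 ≤ L) ∧ (m ≤ 0 → R ≤ 0 ∧ L ≤ 0) ∧
      (0 < m → ((p.1.1 (inner hx i)).2 : ℕ) < x → 0 < R) ∧
      (0 < m → x ≤ ((p.1.1 (inner hx i)).2 : ℕ) → 0 < L) := by
  have key : ∀ (m : ℕ) (p : (pathGraphXY x y n).RotorConfig × (pathGraphXY x y n).ParticleConfig),
      ∃ R L : ℤ, (((pathGraphXY x y n).routingStep (inner hx i) ^ m) p).2 - p.2 =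
        Pi.single ⟨i + 2, by omega⟩ R + Pi.single ⟨i, by omega⟩ L -
          Pi.single ⟨i + 1, by omega⟩ (m : ℤ) ∧
      R + L = m ∧ 0 ≤ R ∧ 0 ≤ L ∧
      (0 < m → ((p.1.1 (inner hx i)).2 : ℕ) < x → 0 < R) ∧
      (0 < m → x ≤ ((p.1.1 (inner hx i)).2 : ℕ) → 0 < L) := by
    intro m
    induction m with
    | zero => exact fun p => ⟨0, 0, by simp⟩
    | succ m ih =>
      intro p
      obtain ⟨R, L, h, hRL, hR, hL, -, -⟩ := ih ((pathGraphXY x y n).routingStep (inner hx i) p)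
      have hfst := rotor_inner_fst hx p.1 i
      have hstep : ((pathGraphXY x y n).routingStep (inner hx i) p).2 = p.2 +
          Pi.single ((pathGraphXY x y n).head (p.1.1 (inner hx i))) 1 -
            Pi.single ⟨i + 1, by omega⟩ 1 := rfl
      rw [pow_succ, Equiv.Perm.mul_apply, ← sub_add_sub_cancel _
        ((pathGraphXY x y n).routingStep (inner hx i) p).2, h, hstep]
      by_cases hj : ((p.1.1 (inner hx i)).2 : ℕ) < x
      · have hh : (pathGraphXY x y n).head (p.1.1 (inner hx i)) = ⟨i + 2, by omega⟩ :=
          (head_of_lt _ hj).trans (Fin.ext (by simp only [hfst]))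
        refine ⟨R + 1, L, ?_, by push_cast; omega, by omega, hL, fun _ _ => by omega,
          fun _ h => by omega⟩
        rw [hh, Pi.single_add]
        push_cast
        rw [Pi.single_add]
        abel
      · have hh : (pathGraphXY x y n).head (p.1.1 (inner hx i)) = ⟨i, by omega⟩ :=
          (head_of_le _ (not_lt.mp hj)).trans (Fin.ext (by simp only [hfst]))
        refine ⟨R, L + 1, ?_, by push_cast; omega, hR, by omega, fun _ _ => by omega,
          fun _ h => by omega⟩
        rw [hh, Pi.single_add]
        push_cast
        rw [Pi.single_add]
        abel
  obtain ⟨k, rfl | rfl⟩ := m.eq_nat_or_neg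
  · obtain ⟨R, L, h, hRL, hR, hL, hR', hL'⟩ := key k p
    exact ⟨R, L, by exact_mod_cast h, hRL, fun _ => ⟨hR, hL⟩, fun _ => by omega,
      fun hk => hR' (by omega), fun hk => hL' (by omega)⟩
  · obtain ⟨R, L, h, hRL, hR, hL, -, -⟩ :=
      key k (((pathGraphXY x y n).routingStep (inner hx i) ^ (-(k : ℤ))) p)
    simp only [← Equiv.Perm.mul_apply, ← zpow_natCast, ← zpow_add, add_neg_cancel, zpow_zero,
      Equiv.Perm.one_apply] at h
    refine ⟨-R, -L, ?_, by omega, fun _ => by omega, fun _ => by omega, fun hk => by omega,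
      fun hk => by omega⟩
    rw [← neg_sub, h, Pi.single_neg, Pi.single_neg, Pi.single_neg]
    abel

/-- A routing that restores the number of particles at the non-sink vertices is a constant flow:
if `R k` and `L k` are the numbers of moves out of `u_k` to the right and to the left, then the net
flow `R k - L (k + 1)` along each edge of the path is the number of particles gained by the right
sink. The values `R 0` and `L (n + 1)` at the sinks are `0`. -/
theorem exists_flow (hx : 0 < x) (r : (pathGraphXY x y n).V₀ → ℤ)
    {p q : (pathGraphXY x y n).RotorConfig × (pathGraphXY x y n).ParticleConfig}
    (hr : (pathGraphXY x y n).routing r p = q)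
    (hV : ∀ u : (pathGraphXY x y n).V₀, q.2 u = p.2 u) :
    ∃ R L : ℕ → ℤ, R 0 = 0 ∧ L (n + 1) = 0 ∧
      (∀ k ≤ n, R k - L (k + 1) = q.2 (Fin.last (n + 1)) - p.2 (Fin.last (n + 1))) ∧
      q.2 0 - p.2 0 = L 1 ∧
      ∀ i : Fin n, (0 ≤ r (inner hx i) → 0 ≤ R (i + 1) ∧ 0 ≤ L (i + 1)) ∧
        (r (inner hx i) ≤ 0 → R (i + 1) ≤ 0 ∧ L (i + 1) ≤ 0) ∧
        (0 < r (inner hx i) → ((p.1.1 (inner hx i)).2 : ℕ) < x → 0 < R (i + 1)) ∧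
        (0 < r (inner hx i) → x ≤ ((p.1.1 (inner hx i)).2 : ℕ) → 0 < L (i + 1)) := by
  choose R L hdisp hsum hpos hneg hright hleft using
    fun i : Fin n => exists_right_left hx i (r (inner hx i)) p
  -- Functions on the non-sink vertices are extended by `0`, with `u_{i+1}` at the argument `i + 1`.
  let ext (f : Fin n → ℤ) (k : ℕ) : ℤ := ∑ i : Fin n, if (i : ℕ) + 1 = k then f i else 0
  have ext_succ (f : Fin n → ℤ) (i : Fin n) : ext f (i + 1) = f i := by
    simp only [ext, Nat.add_right_cancel_iff, ← Fin.ext_iff]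
    simp
  have ext_out (f : Fin n → ℤ) (k : ℕ) (hk : k = 0 ∨ n < k) : ext f k = 0 :=
    Finset.sum_eq_zero fun i _ => if_neg (by omega)
  have hval (j : Fin (n + 2)) :
      q.2 j - p.2 j = ext R (j - 1) + ext L (j + 1) - ext (fun i => r (inner hx i)) j := by
    rw [← hr, RotorGraph.routing_particle, Pi.add_apply, add_sub_cancel_left, Finset.sum_apply,
      ← (inner hx).sum_comp, ← Finset.sum_add_distrib, ← Finset.sum_sub_distrib]
    refine Finset.sum_congr rfl fun i _ => ?_
    rw [hdisp i, Pi.sub_apply, Pi.add_apply, Pi.single_apply, Pi.single_apply, Pi.single_apply]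
    simp only [Fin.ext_iff]
    congr 2
    · congr 1
      exact propext ⟨fun h => by omega, fun h => by omega⟩
    · congr 1
      exact propext ⟨fun h => by omega, fun h => by omega⟩
    · exact propext ⟨fun h => by omega, fun h => by omega⟩
  have hstep (k : ℕ) (hk : k < n) :
      ext R k - ext L (k + 1) = ext R (k + 1) - ext L (k + 1 + 1) := by
    have h1 := hval (inner (y := y) hx ⟨k, hk⟩).1
    rw [hV, sub_self] at h1
    have h2 : (((inner (y := y) hx ⟨k, hk⟩).1 : Fin (n + 2)) : ℕ) = k + 1 := rfl
    rw [h2, Nat.add_sub_cancel] at h1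
    have h3 := ext_succ R ⟨k, hk⟩
    have h4 := ext_succ L ⟨k, hk⟩
    have h5 := ext_succ (fun i => r (inner hx i)) ⟨k, hk⟩
    have h6 := hsum ⟨k, hk⟩
    simp only at h3 h4 h5
    omega
  have hlast : q.2 (Fin.last (n + 1)) - p.2 (Fin.last (n + 1)) = ext R n - ext L (n + 1) := by
    rw [hval, Fin.val_last, Nat.add_sub_cancel, ext_out L (n + 1) (by omega),
      ext_out L (n + 1 + 1) (by omega), ext_out _ (n + 1) (by omega)]
    ring
  refine ⟨ext R, ext L, ext_out _ _ (by omega), ext_out _ _ (by omega), fun k hk => ?_, ?_,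
    fun i => ?_⟩
  · rw [hlast]
    induction hk using Nat.decreasingInduction with
    | self => rfl
    | of_succ k hk ih => rw [hstep k hk, ih]
  · rw [hval]
    simp [ext_out]
  · rw [ext_succ, ext_succ]
    exact ⟨hpos i, hneg i, hright i, hleft i⟩

/-- No equivalence between configurations that agree at the non-sink vertices carries particles
from the left sink to the right one: the number of particles sent to the left would be negative
at every `u_k`, by induction from `u_1` on, and then at the right sink too, which sends none. -/
theorem last_le_of_rpEquiv (hx : 0 < x)
    {p q : (pathGraphXY x y n).RotorConfig × (pathGraphXY x y n).ParticleConfig}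
    (h : (pathGraphXY x y n).RPEquiv p q)
    (hV : ∀ u : (pathGraphXY x y n).V₀, q.2 u = p.2 u) :
    q.2 (Fin.last (n + 1)) ≤ p.2 (Fin.last (n + 1)) := by
  obtain ⟨r, hr⟩ := h
  obtain ⟨R, L, hR, hL, hc, -, hs⟩ := exists_flow hx r hr hV
  by_contra! hlt
  have key : ∀ k ≤ n, L (k + 1) < 0 := by
    intro k
    induction k with
    | zero => intro hk; have := hc 0 hk; omega
    | succ k ih =>
      intro hk
      have h1 := ih (by omega)
      have h2 := hc (k + 1) hk
      obtain ⟨h3, h4, -⟩ := hs ⟨k, hk⟩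
      simp only at h3 h4
      rcases le_total 0 (r (inner hx ⟨k, hk⟩)) with h | h
      · have := h3 h; omega
      · have := h4 h; omega
  have := key n le_rfl
  omega

/-- Equivalent configurations that agree at the non-sink vertices agree at the sinks too. -/
theorem eq_of_rpEquiv (hx : 0 < x)
    {p q : (pathGraphXY x y n).RotorConfig × (pathGraphXY x y n).ParticleConfig}
    (h : (pathGraphXY x y n).RPEquiv p q)
    (hV : ∀ u : (pathGraphXY x y n).V₀, q.2 u = p.2 u) : q.2 = p.2 := by
  have hlast : q.2 (Fin.last (n + 1)) = p.2 (Fin.last (n + 1)) :=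
    le_antisymm (last_le_of_rpEquiv hx h hV)
      (last_le_of_rpEquiv hx h.symm fun u => (hV u).symm)
  obtain ⟨r, hr⟩ := h
  obtain ⟨R, L, hR, -, hc, h0, -⟩ := exists_flow hx r hr hV
  funext j
  by_cases hj : j.val = 0
  · obtain rfl : j = 0 := Fin.ext hj
    have := hc 0 (Nat.zero_le _)
    rw [zero_add] at this
    omega
  by_cases hj' : j.val = n + 1
  · obtain rfl : j = Fin.last (n + 1) := Fin.ext hj'
    exact hlast
  · have hj1 : ((inner (y := y) hx (⟨j - 1, by omega⟩ : Fin n)).1 : Fin (n + 2)) = j :=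
      Fin.ext (Nat.sub_add_cancel (by omega))
    rw [← hj1, hV]

/-! ### Forests -/

/-- A rotor configuration without cycles: the rotors at `u_1, …, u_m` point to the left and the
following ones to the right. -/
def IsForest (hx : 0 < x) (m : ℕ) (ρ : (pathGraphXY x y n).RotorConfig) : Prop :=
  ∀ i : Fin n, x ≤ ((ρ.1 (inner hx i)).2 : ℕ) ↔ (i : ℕ) < m

/-- No rotor of a forest is advanced in a particle-preserving routing. The flow is `0`, so a particle
sent to the right by `u_k` comes back from `u_{k+1}`, whose rotor is then advanced and also starts
to the right; in the end the right sink would have to send a particle back. Likewise on the left. -/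
theorem IsForest.routing_nonpos (hx : 0 < x) {m : ℕ} {ρ : (pathGraphXY x y n).RotorConfig}
    (hρ : IsForest hx m ρ) {r : (pathGraphXY x y n).V₀ → ℤ}
    {ρ' : (pathGraphXY x y n).RotorConfig} {σ : (pathGraphXY x y n).ParticleConfig}
    (hr : (pathGraphXY x y n).routing r (ρ, σ) = (ρ', σ)) (u : (pathGraphXY x y n).V₀) :
    r u ≤ 0 := by
  obtain ⟨R, L, hR, hL, hc, -, hs⟩ := exists_flow hx r hr fun _ => rfl
  simp only [sub_self] at hc
  have hright : ∀ k ≤ n, m ≤ k → L (k + 1) ≤ 0 := by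
    intro k hk
    induction hk using Nat.decreasingInduction with
    | self => intro _; omega
    | of_succ k hk ih =>
      intro hm
      have h1 := ih (by omega)
      have h2 := hc (k + 1) hk
      obtain ⟨-, h3, h4, -⟩ := hs ⟨k, hk⟩
      have h5 := hρ ⟨k, hk⟩
      simp only at h3 h4 h5
      by_contra! h6
      have h7 : 0 < r (inner hx ⟨k, hk⟩) := by
        by_contra! h7
        have := h3 h7
        omega
      have := h4 h7 (by omega)
      omega
  have hleft : ∀ k ≤ n, k ≤ m → R k ≤ 0 := by
    intro k
    induction k with
    | zero => intro _ _; omega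
    | succ k ih =>
      intro hk hm
      have h1 := ih (by omega) (by omega)
      have h2 := hc k (by omega)
      obtain ⟨-, h3, -, h4⟩ := hs ⟨k, hk⟩
      have h5 := hρ ⟨k, hk⟩
      simp only at h3 h4 h5
      by_contra! h6
      have h7 : 0 < r (inner hx ⟨k, hk⟩) := by
        by_contra! h7
        have := h3 h7
        omega
      have := h4 h7 (by omega)
      omega
  obtain ⟨i, rfl⟩ := (inner hx).surjective u
  by_contra! hpos
  obtain ⟨-, -, h3, h4⟩ := hs i
  by_cases hi : (i : ℕ) < m
  · have h1 := h4 hpos ((hρ i).mpr hi)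
    have h2 := hc i i.2.le
    have h5 := hleft i i.2.le hi.le
    omega
  · have h1 := h3 hpos (not_le.mp fun h => hi ((hρ i).mp h))
    have h2 := hc (i + 1) i.2
    have h5 := hright (i + 1) i.2 (by omega)
    omega

/-- An equivalence class of rotor configurations contains at most one forest. -/
theorem IsForest.eq_of_rotorEquiv (hx : 0 < x) {m m' : ℕ}
    {ρ ρ' : (pathGraphXY x y n).RotorConfig}
    (hρ : IsForest hx m ρ) (hρ' : IsForest hx m' ρ')
    (h : (pathGraphXY x y n).RotorEquiv ρ ρ') : ρ = ρ' := by
  obtain ⟨σ, r, hr⟩ := h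
  have hr' : (pathGraphXY x y n).routing (-r) (ρ', σ) = (ρ, σ) := by
    rw [RotorGraph.routing_neg, Equiv.Perm.inv_eq_iff_eq, hr]
  have h0 : r = 0 := funext fun u => le_antisymm (hρ.routing_nonpos hx hr u)
    (by simpa using hρ'.routing_nonpos hx hr' u)
  rw [h0, RotorGraph.routing_zero] at hr
  exact congrArg Prod.fst hr

/-- Encoding of the forests: the number `m` of rotors pointing to the left, and for each rotor its
position among the arcs of its direction. -/
abbrev ForestCode (x y n : ℕ) : Type :=
  Σ m : Fin (n + 1), (i : Fin n) → Fin (if (i : ℕ) < m then y else x)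

theorem card_forestCode : Fintype.card (ForestCode x y n) = pathF x y n := by
  rw [Fintype.card_sigma, pathF, Finset.sum_range]
  refine Finset.sum_congr rfl fun m _ => ?_
  simp only [Fintype.card_pi, Fintype.card_fin]
  rw [Finset.prod_ite, Finset.prod_const, Finset.prod_const]
  have h1 : (Finset.univ.filter fun i : Fin n => (i : ℕ) < m).card = m := by
    rw [Fin.card_filter_val_lt]; omega
  have h2 : (Finset.univ.filter fun i : Fin n => ¬ (i : ℕ) < m).card = n - m := by
    have := Finset.card_filter_add_card_filter_not (s := (Finset.univ : Finset (Fin n)))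
      (fun i : Fin n => (i : ℕ) < m)
    rw [h1, Finset.card_univ, Fintype.card_fin] at this
    omega
  rw [h1, h2, mul_comm]

/-- The arc out of `u_{i+1}` which a forest code describes. -/
def ForestCode.arc (c : ForestCode x y n) (i : Fin n) : Fin n × Fin (x + y) :=
  (i, ⟨if (i : ℕ) < c.1 then x + c.2 i else c.2 i, by
    have := (c.2 i).2
    split_ifs at * <;> omega⟩)

/-- The forest with a given code. -/
noncomputable def ForestCode.toConfig (hx : 0 < x) (c : ForestCode x y n) :
    (pathGraphXY x y n).RotorConfig :=
  ⟨fun u => c.arc ((inner hx).symm u), fun u => by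
    conv_rhs => rw [← (inner hx).apply_symm_apply u]
    rfl⟩

theorem ForestCode.val_toConfig_inner (hx : 0 < x) (c : ForestCode x y n) (i : Fin n) :
    (((c.toConfig hx).1 (inner hx i)).2 : ℕ) = if (i : ℕ) < c.1 then x + c.2 i else c.2 i := by
  have h : (c.toConfig hx).1 (inner hx i) = c.arc i :=
    congrArg c.arc ((inner hx).symm_apply_apply i)
  rw [h, arc]

theorem ForestCode.isForest (hx : 0 < x) (c : ForestCode x y n) :
    IsForest hx c.1 (c.toConfig hx) := by
  intro i
  rw [val_toConfig_inner]
  have := (c.2 i).2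
  split_ifs at * with h
  · simp [h]
  · simpa [h] using this

theorem ForestCode.toConfig_injective (hx : 0 < x) :
    Function.Injective (toConfig hx : ForestCode x y n → _) := by
  intro c c' h
  have h1 : c.1 = c'.1 := by
    have h2 (i : Fin n) : (i : ℕ) < c.1 ↔ (i : ℕ) < c'.1 := by
      rw [← c.isForest hx i, ← c'.isForest hx i, h]
    by_contra hne
    rcases lt_or_gt_of_ne hne with hlt | hlt
    · have := h2 ⟨c.1, by omega⟩
      simp only [lt_self_iff_false, false_iff] at this
      exact this hlt
    · have := h2 ⟨c'.1, by omega⟩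
      simp only [lt_self_iff_false, iff_false] at this
      exact this hlt
  obtain ⟨m, f⟩ := c
  obtain ⟨m', f'⟩ := c'
  obtain rfl : m = m' := h1
  congr 1
  funext i
  have h2 := val_toConfig_inner hx ⟨m, f⟩ i
  rw [h, val_toConfig_inner] at h2
  split_ifs at h2 <;> exact Fin.ext (by simp only at h2; omega)

/-! ### The sandpile group -/

theorem pathHVertex_succ (k : ℕ) (hk : k ≤ n) :
    pathHVertex x y n ⟨k + 1, by omega⟩ =
      pathHVertex x y n ⟨k, by omega⟩ + (x : ℤ) ^ (n - k) * (y : ℤ) ^ k :=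
  Finset.sum_range_succ _ _

theorem θ_pow_card (a : Fin n × Fin (x + y)) : ((pathGraphXY x y n).θ ^ (x + y)) a = a := by
  have h : ∀ t : ℕ, ((pathGraphXY x y n).θ ^ t) a = (a.1, (finRotate (x + y) ^ t) a.2) := by
    intro t
    induction t with
    | zero => rfl
    | succ t ih => rw [pow_succ', Equiv.Perm.mul_apply, ih, pow_succ']; rfl
  rw [h, finRotate_pow_self]
  rfl

/-- A full turn of the rotor at `u_{i+1}` sends `x` particles to the right and `y` to the left. The
two numbers are read off from the invariance of `h(σ) - g(ρ)`. -/
theorem particleEquiv_full_turn (hx : 0 < x) (hy : 0 < y) (i : Fin n) :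
    (pathGraphXY x y n).ParticleEquiv 0 (Pi.single ⟨i + 2, by omega⟩ (x : ℤ) +
      Pi.single ⟨i, by omega⟩ (y : ℤ) - Pi.single ⟨i + 1, by omega⟩ ((x : ℤ) + y)) := by
  obtain ⟨ρ⟩ := (pathGraphXY x y n).nonempty_rotorConfig
  obtain ⟨R, L, hdisp, hsum, -⟩ := exists_right_left hx i (x + y : ℤ) (ρ, 0)
  have hρ : (((pathGraphXY x y n).routingStep (inner hx i) ^ ((x : ℤ) + y)) (ρ, 0)).1 = ρ := by
    refine Subtype.ext (funext fun v => ?_)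
    rw [RotorGraph.routingStep_zpow_rotor]
    split_ifs
    · exact_mod_cast θ_pow_card _
    · rfl
  rw [sub_zero] at hdisp
  have hequiv : (pathGraphXY x y n).RPEquiv (ρ, 0) (ρ, Pi.single ⟨i + 2, by omega⟩ R +
      Pi.single ⟨i, by omega⟩ L - Pi.single ⟨i + 1, by omega⟩ ((x : ℤ) + y)) :=
    ⟨Pi.single (inner hx i) (x + y), by rw [RotorGraph.routing_single]; exact Prod.ext hρ hdisp⟩
  have hinv := pathH_sub_pathG_eq hequiv
  rw [map_zero, map_sub, map_add, pathH_single, pathH_single, pathH_single,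
    pathHVertex_succ (i + 1) i.2, pathHVertex_succ i i.2.le,
    show n - (i : ℕ) = n - (i + 1) + 1 by omega] at hinv
  obtain ⟨c, hc⟩ : ∃ c : ℤ, c = (x : ℤ) ^ (n - (i + 1 : ℕ)) * (y : ℤ) ^ (i : ℕ) := ⟨_, rfl⟩
  have hc0 : c ≠ 0 := by rw [hc]; positivity
  have h1 : c * ((x + y) * (R - x)) = 0 := by
    rw [hc]
    obtain rfl : L = x + y - R := by omega
    linear_combination hinv
  have h2 : R - x = 0 :=
    (mul_eq_zero.mp ((mul_eq_zero.mp h1).resolve_left hc0)).resolve_left (by omega)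
  obtain rfl : R = x := by omega
  obtain rfl : L = y := by omega
  exact ⟨ρ, hequiv⟩

/-- The class of a particle configuration in the sandpile group. -/
abbrev sandpileMk (x y n : ℕ) :
    (pathGraphXY x y n).ParticleConfig →+ (pathGraphXY x y n).SandpileGroup :=
  (pathGraphXY x y n).sandpileCon.mk'

theorem sandpileMk_eq_iff {σ τ : (pathGraphXY x y n).ParticleConfig} :
    sandpileMk x y n σ = sandpileMk x y n τ ↔ (pathGraphXY x y n).SandpileEquiv σ τ :=
  AddCon.eq _

theorem sandpileMk_eq_zero_of_sinks {σ : (pathGraphXY x y n).ParticleConfig}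
    (h : ∀ u : (pathGraphXY x y n).V₀, σ u = 0) : sandpileMk x y n σ = 0 := by
  rw [← map_zero (sandpileMk x y n), sandpileMk_eq_iff]
  obtain ⟨ρ⟩ := (pathGraphXY x y n).nonempty_rotorConfig
  exact ⟨σ, ⟨ρ, RotorGraph.rpEquiv_refl _ _⟩, fun u => (h u).symm⟩

theorem sandpileMk_single_sink (u : Fin (n + 2)) (hu : u = 0 ∨ u = Fin.last (n + 1)) :
    sandpileMk x y n (Pi.single u 1) = 0 := by
  refine sandpileMk_eq_zero_of_sinks fun v => Pi.single_eq_of_ne ?_ _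
  rintro rfl
  obtain ⟨a, ha⟩ := v.2
  have h1 : (a.1 : ℕ) + 1 = (v.1 : ℕ) := congrArg Fin.val ha
  have h2 := a.1.2
  rcases hu with h | h
  · rw [h, Fin.val_zero] at h1; omega
  · rw [h, Fin.val_last] at h1; omega

/-- A homomorphism which vanishes on the sinks and on full turns has all its values among the
multiples of one element `e`, by `σ ↦ h(σ) e`, and `F e = 0` is the value at the right sink. -/
theorem eq_zero_of_dvd_pathH {M : Type*} [AddCommGroup M] (hcop : x.Coprime y)
    (φ : (pathGraphXY x y n).ParticleConfig →+ M) (h0 : φ (Pi.single 0 1) = 0)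
    (hlast : φ (Pi.single (Fin.last (n + 1)) 1) = 0)
    (hturn : ∀ i : Fin n, φ (Pi.single ⟨i + 2, by omega⟩ (x : ℤ) +
      Pi.single ⟨i, by omega⟩ (y : ℤ) - Pi.single ⟨i + 1, by omega⟩ ((x : ℤ) + y)) = 0)
    (σ : (pathGraphXY x y n).ParticleConfig) (hσ : (pathF x y n : ℤ) ∣ pathHHom x y n σ) :
    φ σ = 0 := by
  have hsingle (u : Fin (n + 2)) (m : ℤ) : φ (Pi.single u m) = m • φ (Pi.single u 1) := by
    rw [← map_zsmul, ← Pi.single_smul, smul_eq_mul, mul_one]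
  let v (k : ℕ) : M := if h : k < n + 2 then φ (Pi.single ⟨k, h⟩ 1) else 0
  have hv (k : ℕ) (h : k < n + 2) : v k = φ (Pi.single ⟨k, h⟩ 1) := dif_pos h
  obtain ⟨e, he⟩ := exists_eq_pow_mul_pow_smul hcop (fun k => v (k + 1) - v k) n fun k hk => by
    have h := hturn ⟨k, hk⟩
    rw [map_sub, map_add, hsingle _ (x : ℤ), hsingle _ (y : ℤ), hsingle _ ((x : ℤ) + y),
      ← hv (k + 2), ← hv k, ← hv (k + 1), add_smul] at h
    rw [← sub_eq_zero, smul_sub, smul_sub, ← h]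
    abel
  have hvk : ∀ k (h : k < n + 2), v k = pathHVertex x y n ⟨k, h⟩ • e := by
    intro k
    induction k with
    | zero =>
      intro h
      rw [hv 0 h]
      exact h0.trans (by simp [pathHVertex])
    | succ k ih =>
      intro h
      rw [pathHVertex_succ k (by omega), add_smul, ← ih (by omega), ← he k (by omega)]
      abel
  have hφ : φ σ = pathHHom x y n σ • e := by
    rw [← Finset.univ_sum_single σ, map_sum, map_sum, Finset.sum_smul]
    refine Finset.sum_congr rfl fun u _ => ?_
    rw [hsingle, ← hv u u.2, hvk u u.2, pathH_single, mul_smul]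
  have hF : (pathF x y n : ℤ) • e = 0 := by
    rw [← pathHVertex_last, ← hlast]
    exact (hvk (n + 1) (by omega)).symm.trans (hv (n + 1) (by omega))
  obtain ⟨t, ht⟩ := hσ
  rw [hφ, ht, mul_comm, mul_smul, hF, smul_zero]

theorem dvd_pathH_of_sinks (hx : 0 < x) {σ : (pathGraphXY x y n).ParticleConfig}
    (h : ∀ u : (pathGraphXY x y n).V₀, σ u = 0) : (pathF x y n : ℤ) ∣ pathHHom x y n σ := by
  change (pathF x y n : ℤ) ∣ ∑ j, σ j * pathHVertex x y n j
  change (pathF x y n : ℤ) ∣ ∑ j, σ j * pathHVertex x y n j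
  refine Finset.dvd_sum fun j _ => ?_
  by_cases hj : j.val = 0
  · obtain rfl : j = 0 := Fin.ext hj
    simp [pathHVertex_zero]
  by_cases hj' : j.val = n + 1
  · obtain rfl : j = Fin.last (n + 1) := Fin.ext hj'
    rw [pathHVertex_last]
    exact dvd_mul_left _ _
  · have hj1 : ((inner (y := y) hx (⟨j - 1, by omega⟩ : Fin n)).1 : Fin (n + 2)) = j :=
      Fin.ext (Nat.sub_add_cancel (by omega))
    rw [← hj1, h, zero_mul]
    exact dvd_zero _

theorem sandpileMk_eq_zero_iff (hx : 0 < x) (hy : 0 < y) (hcop : x.Coprime y)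
    (σ : (pathGraphXY x y n).ParticleConfig) :
    sandpileMk x y n σ = 0 ↔ (pathF x y n : ℤ) ∣ pathHHom x y n σ := by
  constructor
  · rw [← map_zero (sandpileMk x y n), sandpileMk_eq_iff]
    rintro ⟨σ₁, ⟨ρ, h⟩, h'⟩
    have h1 := pathH_sub_pathG_eq h
    rw [sub_left_inj] at h1
    rw [← h1]
    exact dvd_pathH_of_sinks hx fun u => (h' u).symm
  · refine eq_zero_of_dvd_pathH hcop _ (sandpileMk_single_sink _ (Or.inl rfl))
      (sandpileMk_single_sink _ (Or.inr rfl)) (fun i => ?_) σ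
    rw [← map_zero (sandpileMk x y n), eq_comm, sandpileMk_eq_iff]
    exact ⟨_, particleEquiv_full_turn hx hy i, fun _ => rfl⟩

theorem exists_rpEquiv_sinks (hx : 0 < x) (hy : 0 < y) (hcop : x.Coprime y)
    {σ : (pathGraphXY x y n).ParticleConfig} (hσ : (pathF x y n : ℤ) ∣ pathHHom x y n σ)
    (ρ : (pathGraphXY x y n).RotorConfig) :
    ∃ σ', (pathGraphXY x y n).RPEquiv (ρ, σ) (ρ, σ') ∧
      ∀ u : (pathGraphXY x y n).V₀, σ' u = 0 := by
  have h := (sandpileMk_eq_zero_iff hx hy hcop σ).mpr hσ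
  rw [← map_zero (sandpileMk x y n), sandpileMk_eq_iff] at h
  obtain ⟨σ', h1, h2⟩ := h
  exact ⟨σ', h1.all ρ, fun u => (h2 u).symm⟩

/-! ### Rotor classes -/

theorem pathG_eq_of_rotorEquiv {ρ ρ' : (pathGraphXY x y n).RotorConfig}
    (h : (pathGraphXY x y n).RotorEquiv ρ ρ') : pathG x y n ρ = pathG x y n ρ' := by
  obtain ⟨σ, h⟩ := h
  exact (sub_right_inj.mp (pathH_sub_pathG_eq h)).symm

/-- Routing `ρ` to `ρ'` displaces particles of total potential `g(ρ') - g(ρ)`. If `F` divides it,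
they can be moved on to the sinks, and no particle is then left to account for. -/
theorem rotorEquiv_of_pathG_eq (hx : 0 < x) (hy : 0 < y) (hcop : x.Coprime y)
    {ρ ρ' : (pathGraphXY x y n).RotorConfig}
    (h : (pathG x y n ρ : ZMod (pathF x y n)) = pathG x y n ρ') :
    (pathGraphXY x y n).RotorEquiv ρ ρ' := by
  obtain ⟨τ, hτ⟩ := (pathGraphXY x y n).exists_routing_rotor ρ ρ'
  have h1 := pathH_sub_pathG_eq hτ
  have h2 : pathHHom x y n τ = pathG x y n ρ' - pathG x y n ρ := by
    rw [map_zero] at h1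
    linear_combination h1
  obtain ⟨τ', h3, h4⟩ := exists_rpEquiv_sinks hx hy hcop
    (h2 ▸ (ZMod.intCast_eq_intCast_iff_dvd_sub _ _ _).mp h) ρ'
  have h5 := hτ.trans h3
  obtain rfl : τ' = 0 := eq_of_rpEquiv hx h5 h4
  exact ⟨0, h5⟩

theorem pathF_pos (hx : 0 < x) : 0 < pathF x y n :=
  Finset.sum_pos' (fun _ _ => Nat.zero_le _) ⟨0, by simp, by simpa using Nat.pow_pos hx⟩

/-- Every residue is attained at a forest: there are `F` of them, and `g` separates them. -/
theorem exists_pathG_eq (hx : 0 < x) (hy : 0 < y) (hcop : x.Coprime y) (z : ZMod (pathF x y n)) :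
    ∃ ρ : (pathGraphXY x y n).RotorConfig, (pathG x y n ρ : ZMod (pathF x y n)) = z := by
  have : NeZero (pathF x y n) := ⟨(pathF_pos hx).ne'⟩
  have hinj : Function.Injective fun c : ForestCode x y n =>
      (pathG x y n (c.toConfig hx) : ZMod (pathF x y n)) := fun c c' h =>
    ForestCode.toConfig_injective hx ((c.isForest hx).eq_of_rotorEquiv hx (c'.isForest hx)
      (rotorEquiv_of_pathG_eq hx hy hcop h))
  obtain ⟨c, hc⟩ := ((Fintype.bijective_iff_injective_and_card _).mpr
    ⟨hinj, by rw [card_forestCode, ZMod.card]⟩).2 z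
  exact ⟨_, hc⟩

/-! ### The isomorphism with the integers modulo `F` -/

theorem coprime_pathF (hcop : x.Coprime y) : x.Coprime (pathF x y n) := by
  have h : x ∣ ∑ i ∈ Finset.range n, x ^ (n - i) * y ^ i := Finset.dvd_sum fun i hi =>
    (dvd_pow_self x (Nat.sub_ne_zero_of_lt (Finset.mem_range.mp hi))).mul_right _
  obtain ⟨s, hs⟩ := h
  rw [pathF, Finset.sum_range_succ, hs, tsub_self, pow_zero, one_mul,
    Nat.coprime_mul_left_add_right]
  exact hcop.pow_right n

/-- The reduction of `h` modulo `F` on the sandpile group. -/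
noncomputable def sandpileHom (hx : 0 < x) (hy : 0 < y) (hcop : x.Coprime y) :
    (pathGraphXY x y n).SandpileGroup →+ ZMod (pathF x y n) :=
  AddCon.lift _ ((Int.castAddHom (ZMod (pathF x y n))).comp (pathHHom x y n)) fun σ τ h => by
    have h1 : sandpileMk x y n (τ - σ) = 0 := by
      rw [map_sub, sandpileMk_eq_iff.mpr h, sub_self]
    rw [sandpileMk_eq_zero_iff hx hy hcop, map_sub] at h1
    exact (ZMod.intCast_eq_intCast_iff_dvd_sub _ _ _).mpr h1

theorem sandpileHom_bijective (hx : 0 < x) (hy : 0 < y) (hcop : x.Coprime y) :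
    Function.Bijective (sandpileHom (n := n) hx hy hcop) := by
  constructor
  · rw [injective_iff_map_eq_zero]
    intro a ha
    obtain ⟨σ, rfl⟩ := AddCon.mk'_surjective a
    exact (sandpileMk_eq_zero_iff hx hy hcop σ).mpr
      ((ZMod.intCast_zmod_eq_zero_iff_dvd _ _).mp ha)
  · -- `h(u_1) = x^n` is invertible modulo `F`.
    intro z
    obtain ⟨t, rfl⟩ := ZMod.intCast_surjective z
    obtain ⟨a, b, hab⟩ : IsCoprime ((x : ℤ) ^ n) (pathF x y n : ℤ) :=
      (Nat.isCoprime_iff_coprime.mpr (coprime_pathF hcop)).pow_left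
    refine ⟨sandpileMk x y n (Pi.single ⟨1, by omega⟩ (t * a)), ?_⟩
    change ((pathHHom x y n (Pi.single ⟨1, by omega⟩ (t * a)) : ℤ) : ZMod (pathF x y n)) = t
    rw [pathH_single, ZMod.intCast_eq_intCast_iff_dvd_sub]
    refine ⟨t * b, ?_⟩
    simp only [pathHVertex, Finset.sum_range_one, tsub_zero, pow_zero, mul_one]
    linear_combination (-t) * hab

end PathMultigraph

open PathMultigraph

theorem mainTheorem2 (x y n : ℕ) (hx : 0 < x) (hxy : x < y) (hcop : Nat.Coprime x y)
    (hn : 1 ≤ n) :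
    (IsAddCyclic (pathGraphXY x y n).SandpileGroup ∧
      Nat.card (pathGraphXY x y n).SandpileGroup = pathF x y n) ∧
    (∃ e : (pathGraphXY x y n).SandpileGroup ≃+ ZMod (pathF x y n),
      ∀ σ : (pathGraphXY x y n).ParticleConfig,
        e (σ : (pathGraphXY x y n).SandpileGroup) = (pathH x y n σ : ZMod (pathF x y n))) ∧
    (∃ b : (pathGraphXY x y n).RotorClass ≃ ZMod (pathF x y n),
      ∀ ρ : (pathGraphXY x y n).RotorConfig,
        b (Quotient.mk (pathGraphXY x y n).rotorSetoid ρ) =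
          (pathG x y n ρ : ZMod (pathF x y n))) ∧
    (∀ (ρ : (pathGraphXY x y n).RotorConfig) (σ : (pathGraphXY x y n).ParticleConfig),
      ((pathGraphXY x y n).routingInfty (ρ, σ)).Nonempty ∧
      ∀ (ρ' : (pathGraphXY x y n).RotorConfig) (σ' : (pathGraphXY x y n).ParticleConfig),
        (ρ', σ') ∈ (pathGraphXY x y n).routingInfty (ρ, σ) →
        (pathG x y n ρ' : ZMod (pathF x y n)) =
          (pathG x y n ρ : ZMod (pathF x y n)) - (pathH x y n σ : ZMod (pathF x y n))) := by
  have hy : 0 < y := hx.trans hxy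
  have : NeZero (pathF x y n) := ⟨(pathF_pos hx).ne'⟩
  let e : (pathGraphXY x y n).SandpileGroup ≃+ ZMod (pathF x y n) :=
    AddEquiv.ofBijective (sandpileHom hx hy hcop) (sandpileHom_bijective hx hy hcop)
  let g : (pathGraphXY x y n).RotorClass → ZMod (pathF x y n) :=
    Quotient.lift (fun ρ => (pathG x y n ρ : ZMod (pathF x y n)))
      fun _ _ h => congrArg _ (pathG_eq_of_rotorEquiv h)
  have hg : Function.Bijective g := by
    constructor
    · rintro ⟨ρ⟩ ⟨ρ'⟩ h
      exact Quotient.sound (rotorEquiv_of_pathG_eq hx hy hcop h)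
    · intro z
      obtain ⟨ρ, hρ⟩ := exists_pathG_eq hx hy hcop z
      exact ⟨Quotient.mk _ ρ, hρ⟩
  refine ⟨⟨isAddCyclic_of_surjective e.symm e.symm.surjective,
    (Nat.card_congr e.toEquiv).trans (Nat.card_zmod _)⟩, ⟨e, fun _ => rfl⟩,
    ⟨Equiv.ofBijective g hg, fun _ => rfl⟩, fun ρ σ => ⟨?_, ?_⟩⟩
  · -- Route `ρ` to a `ρ'` of the residue that the invariant predicts; the remaining particles
    -- then have potential `0` modulo `F` and can be moved to the sinks.
    obtain ⟨ρ', hρ'⟩ := exists_pathG_eq (n := n) hx hy hcop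
      ((pathG x y n ρ : ZMod (pathF x y n)) - (pathH x y n σ : ZMod (pathF x y n)))
    obtain ⟨τ, hτ⟩ := (pathGraphXY x y n).exists_routing_rotor ρ ρ'
    have h1 := hτ.translate σ
    rw [zero_add] at h1
    have h2 : pathHHom x y n (τ + σ) - pathG x y n ρ' = pathH x y n σ - pathG x y n ρ :=
      pathH_sub_pathG_eq h1
    have h3 : (pathF x y n : ℤ) ∣ pathHHom x y n (τ + σ) := by
      have h4 := congrArg (Int.cast : ℤ → ZMod (pathF x y n)) h2
      push_cast at h4
      rw [hρ'] at h4
      rw [← ZMod.intCast_zmod_eq_zero_iff_dvd]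
      linear_combination h4
    obtain ⟨σ', h5, h6⟩ := exists_rpEquiv_sinks hx hy hcop h3 ρ'
    exact ⟨(ρ', σ'), h1.trans h5, h6⟩
  · rintro ρ' σ' ⟨h, h0⟩
    have h1 : pathHHom x y n σ' - pathG x y n ρ' = pathH x y n σ - pathG x y n ρ :=
      pathH_sub_pathG_eq h
    have h2 := (ZMod.intCast_zmod_eq_zero_iff_dvd _ _).mpr (dvd_pathH_of_sinks hx h0)
    have h3 := congrArg (Int.cast : ℤ → ZMod (pathF x y n)) h1
    push_cast at h3
    linear_combination h2 - h3
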